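/- All rings are associative with identity. A ring $R$ is (von Neumann) regular if for every $a\in R$ there is $x\in R$ with $axa=a$. It is D-regularly nil clean if for every $a\in R$ there is an idempotent $e\in aRa$ such that $a(1-e)$ is nilpotent. It is clean if every element of $R$ is a sum $e+u$ of an idempotent $e$ and a unit $u$, and strongly clean if, in addition, $e$ and $u$ can always be chosen with $ue=eu$. There exists a D-regularly nil clean ring that is neither clean nor strongly clean. More precisely, there exists a regular ring $R$ which is not generated by its units (that is, the subring of $R$ generated by the units of $R$ is not all of $R$), and which is D-regularly nil clean, not clean, and not strongly clean. -/

import Mathlib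

/-- A ring is (von Neumann) regular if every `a` satisfies `a * x * a = a` for some `x`. -/
def IsVonNeumannRegularRing (R : Type*) [Ring R] : Prop :=
  ∀ a : R, ∃ x : R, a * x * a = a

/-- A ring is generated by its units if the smallest subring containing all units is the
whole ring. -/
def IsGeneratedByUnits (R : Type*) [Ring R] : Prop :=
  Subring.closure {u : R | IsUnit u} = ⊤

/-- A ring is clean if every element is the sum of an idempotent and a unit. -/
def IsCleanRing (R : Type*) [Ring R] : Prop :=
  ∀ a : R, ∃ e u : R, IsIdempotentElem e ∧ IsUnit u ∧ a = e + u

/-- A ring is strongly clean if every element is the sum of an idempotent and a unit that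
commute with each other. -/
def IsStronglyCleanRing (R : Type*) [Ring R] : Prop :=
  ∀ a : R, ∃ e u : R, IsIdempotentElem e ∧ IsUnit u ∧ u * e = e * u ∧ a = e + u

/-- A ring is D-regularly nil clean (double regularly nil clean) if for every `a` there is an
idempotent `e` in `aRa` such that `a * (1 - e)` is nilpotent. -/
def IsDRegularlyNilClean (R : Type*) [Ring R] : Prop :=
  ∀ a : R, ∃ e : R, IsIdempotentElem e ∧ (∃ r : R, e = a * r * a) ∧ IsNilpotent (a * (1 - e))

open PowerSeries

/-! Every regular ring is D-regularly nil clean, so a regular ring whose units generate too little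
suffices. In Bergman's ring an endomorphism of `F⟦X⟧` acts as multiplication by a symbol `q ∈ K` on
a subspace of finite codimension. Passing to symbols is a ring homomorphism into a field, so
idempotents have symbol 0 or 1. An index count (`symbol_mem_range_of_isUnit`) puts the symbols of
units in `F⟦X⟧`. Yet `X⁻¹` is a symbol, so the ring is neither generated by its units nor clean. -/

/-! ### Regular rings and D-regular nil cleanness -/

theorem IsVonNeumannRegularRing.exists_reflexive_inverse {R : Type*} [Ring R]
    (h : IsVonNeumannRegularRing R) (b : R) : ∃ y : R, b * y * b = b ∧ y * b * y = y := by
  obtain ⟨y, hy⟩ := h b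
  refine ⟨y * b * y, ?_, ?_⟩
  · calc b * (y * b * y) * b = (b * y * b) * y * b := by noncomm_ring
      _ = b := by rw [hy, hy]
  · calc y * b * y * b * (y * b * y) = y * ((b * y * b) * y * b) * y := by noncomm_ring
      _ = y * b * y := by rw [hy, hy]

theorem IsVonNeumannRegularRing.isDRegularlyNilClean {R : Type*} [Ring R]
    (h : IsVonNeumannRegularRing R) : IsDRegularlyNilClean R := by
  intro a
  obtain ⟨x, hx⟩ := h a
  -- With `b = x * a * a * x`, one has `a * b * a = a * a`. For `e = a * x * y * x * a`, idempotency
  -- comes from `y * b * y = y`, and `a * e * a = a * a` from `b * y * b = b`; the latter makes `a *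
  -- (1 - e)` square to zero.
  obtain ⟨y, hy, hy'⟩ := h.exists_reflexive_inverse (x * a * (a * x))
  have key : a * (a * (x * y * x) * a) * a = a * a := by
    calc a * (a * (x * y * x) * a) * a
        = (a * x * a) * (a * (x * y * x) * a) * (a * x * a) := by rw [hx]
      _ = a * (x * a * (a * x) * y * (x * a * (a * x))) * a := by noncomm_ring
      _ = (a * x * a) * (a * x * a) := by rw [hy]; noncomm_ring
      _ = a * a := by rw [hx]
  refine ⟨a * (x * y * x) * a, ?_, ⟨_, rfl⟩, 2, ?_⟩
  · calc a * (x * y * x) * a * (a * (x * y * x) * a)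
        = a * (x * (y * (x * a * (a * x)) * y) * x) * a := by noncomm_ring
      _ = a * (x * y * x) * a := by rw [hy']
  · calc (a * (1 - a * (x * y * x) * a)) ^ 2
        = (a * a - a * (a * (x * y * x) * a) * a) * (1 - a * (x * y * x) * a) := by noncomm_ring
      _ = 0 := by rw [key, sub_self, zero_mul]

theorem IsStronglyCleanRing.isCleanRing {R : Type*} [Ring R] (h : IsStronglyCleanRing R) :
    IsCleanRing R := fun a ↦
  let ⟨e, u, he, hu, _, hau⟩ := h a
  ⟨e, u, he, hu, hau⟩

/-! ### Generalized inverses of linear maps -/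

section LinearMap

variable {F V W : Type*} [Field F] [AddCommGroup V] [Module F V] [AddCommGroup W] [Module F W]

theorem LinearMap.exists_comp_comp_eq_self (f : V →ₗ[F] W) :
    ∃ g : W →ₗ[F] V, ∀ v, f (g (f v)) = f v := by
  obtain ⟨s, hs⟩ := f.rangeRestrict.exists_rightInverse_of_surjective f.range_rangeRestrict
  obtain ⟨g, hg⟩ := s.exists_extend
  refine ⟨g, fun v ↦ ?_⟩
  have h1 : g (f v) = s (f.rangeRestrict v) := LinearMap.congr_fun hg (f.rangeRestrict v)
  rw [h1]
  exact congrArg Subtype.val (LinearMap.congr_fun hs (f.rangeRestrict v))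

/-- A map that is already a generalized inverse of `f` over the subspace `U` can be modified
outside of `U` to be a generalized inverse of `f`. -/
theorem LinearMap.exists_comp_comp_eq_self_of_eqOn (f : V →ₗ[F] V) (U : Submodule F V)
    (t : V →ₗ[F] V) (ht : ∀ v, f v ∈ U → f (t (f v)) = f v) :
    ∃ g : V →ₗ[F] V, (∀ v, f (g (f v)) = f v) ∧ ∀ u ∈ U, g u = t u := by
  obtain ⟨h, hh⟩ := (U.mkQ ∘ₗ f).exists_comp_comp_eq_self
  -- Here `h` inverts `f` modulo `U`, so `f` sends `v - h (U.mkQ (f v))` into `U`, where `t`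
  -- applies. The correction term factors through `U.mkQ` and so vanishes on `U`.
  refine ⟨t + (LinearMap.id - t ∘ₗ f) ∘ₗ h ∘ₗ U.mkQ, fun v ↦ ?_, fun u hu ↦ ?_⟩
  · have h1 := ht (v - h (U.mkQ (f v))) (by
      rw [← Submodule.Quotient.mk_eq_zero, ← Submodule.mkQ_apply, map_sub, map_sub, sub_eq_zero]
      exact (hh v).symm)
    simp only [map_sub] at h1
    simp only [LinearMap.add_apply, LinearMap.comp_apply, LinearMap.sub_apply, LinearMap.id_apply,
      map_add, map_sub]
    rw [add_sub_left_comm, h1, add_sub_cancel]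
  · have : U.mkQ u = 0 := by simpa using hu
    simp [this]

end LinearMap

/-! ### The `X`-adic filtration and Bergman's ring -/

namespace PowerSeries

variable {F : Type*} [Field F]

theorem exists_dvd_X_pow {b : F⟦X⟧} (hb : b ≠ 0) : ∃ n : ℕ, b ∣ X ^ n := by
  obtain ⟨n, hn⟩ := IsDiscreteValuationRing.associated_pow_irreducible hb X_irreducible
  exact ⟨n, hn.dvd⟩

/-- The first `n` coefficients of a power series. -/
noncomputable def firstCoeffs (F : Type*) [Field F] (n : ℕ) : F⟦X⟧ →ₗ[F] (Fin n → F) :=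
  LinearMap.pi fun i ↦ coeff (i : ℕ)

theorem firstCoeffs_eq_zero_iff {n : ℕ} {a : F⟦X⟧} : firstCoeffs F n a = 0 ↔ X ^ n ∣ a := by
  rw [X_pow_dvd_iff, funext_iff]
  exact ⟨fun h m hm ↦ h ⟨m, hm⟩, fun h i ↦ h i i.2⟩

theorem firstCoeffs_surjective (n : ℕ) : Function.Surjective (firstCoeffs F n) := by
  intro v
  refine ⟨mk fun k ↦ if h : k < n then v ⟨k, h⟩ else 0, ?_⟩
  ext i
  simp [firstCoeffs]

/-- A surjective `φ` would induce a surjection from the quotient by `X ^ n`, of dimension `n`, onto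
the quotient by `X ^ (n + 1)`, of dimension `n + 1`. -/
theorem not_surjective_of_X_pow_succ_dvd (φ : F⟦X⟧ →ₗ[F] F⟦X⟧) (n : ℕ)
    (h : ∀ a, X ^ (n + 1) ∣ φ (X ^ n * a)) : ¬ Function.Surjective φ := by
  intro hφ
  obtain ⟨s, hs⟩ := (firstCoeffs F n).exists_rightInverse_of_surjective
    (LinearMap.range_eq_top.2 (firstCoeffs_surjective n))
  have hsurj : Function.Surjective (firstCoeffs F (n + 1) ∘ₗ φ ∘ₗ s) := by
    intro v
    obtain ⟨b, rfl⟩ := firstCoeffs_surjective (n + 1) v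
    obtain ⟨a, rfl⟩ := hφ b
    refine ⟨firstCoeffs F n a, ?_⟩
    have h1 : firstCoeffs F n (s (firstCoeffs F n a) - a) = 0 := by
      rw [map_sub, sub_eq_zero]
      exact LinearMap.congr_fun hs _
    obtain ⟨c, hc⟩ := firstCoeffs_eq_zero_iff.1 h1
    have h2 := firstCoeffs_eq_zero_iff.2 (h c)
    rw [← hc, map_sub, map_sub, sub_eq_zero] at h2
    exact h2
  have := LinearMap.finrank_le_finrank_of_surjective hsurj
  simp at this

/-- The subspace of power series divisible by `X ^ n`. -/
noncomputable def multiplesXPow (F : Type*) [Field F] (n : ℕ) : Submodule F F⟦X⟧ :=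
  LinearMap.ker (firstCoeffs F n)

theorem mem_multiplesXPow {n : ℕ} {a : F⟦X⟧} : a ∈ multiplesXPow F n ↔ X ^ n ∣ a := by
  rw [multiplesXPow, LinearMap.mem_ker, firstCoeffs_eq_zero_iff]

theorem eq_zero_of_forall_X_pow_dvd {a : F⟦X⟧} (h : ∀ n : ℕ, X ^ n ∣ a) : a = 0 := by
  ext n
  exact X_pow_dvd_iff.1 (h (n + 1)) n n.lt_succ_self

/-- The intersections of `I` with the multiples of `X ^ n` form a descending chain; it stabilizes by
finite dimension, and its total intersection is zero. -/
theorem exists_forall_mem_of_X_pow_dvd (I : Submodule F F⟦X⟧) [FiniteDimensional F I] :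
    ∃ n : ℕ, ∀ a ∈ I, X ^ n ∣ a → a = 0 := by
  obtain ⟨n, hn⟩ := IsArtinian.monotone_stabilizes (R := F) (M := I)
    ⟨fun n ↦ OrderDual.toDual ((multiplesXPow F n).comap I.subtype), fun m n hmn a ha ↦
      mem_multiplesXPow.2 ((pow_dvd_pow _ hmn).trans (mem_multiplesXPow.1 ha))⟩
  refine ⟨n, fun a ha hna ↦ eq_zero_of_forall_X_pow_dvd fun m ↦ ?_⟩
  rcases le_total m n with hmn | hmn
  · exact (pow_dvd_pow _ hmn).trans hna
  · have h1 : (⟨a, ha⟩ : I) ∈ (multiplesXPow F n).comap I.subtype := mem_multiplesXPow.2 hna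
    have h2 : (multiplesXPow F n).comap I.subtype = (multiplesXPow F m).comap I.subtype :=
      hn m hmn
    rw [h2] at h1
    exact mem_multiplesXPow.1 h1

variable (F) (K : Type*) [Field K] [Algebra F⟦X⟧ K] [IsFractionRing F⟦X⟧ K]

/-- Bergman's ring: the endomorphisms `φ` of the vector space `F⟦X⟧` which agree with
multiplication by some `q ∈ K` on `X ^ n F⟦X⟧` for some `n`, paired with their symbol `q`. -/
def bergmanRing : Subring (Module.End F F⟦X⟧ × K) where
  carrier := {p | ∃ n : ℕ, ∀ a, X ^ n ∣ a → algebraMap F⟦X⟧ K (p.1 a) = p.2 * algebraMap F⟦X⟧ K a}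
  mul_mem' := by
    rintro ⟨φ, q⟩ ⟨ψ, r⟩ ⟨m, hm⟩ ⟨n, hn⟩
    -- The extra `m` ensures that `ψ` lands in the multiples of `X ^ m`, where `φ` acts as its
    -- symbol.
    refine ⟨n + m, ?_⟩
    rintro _ ⟨b, rfl⟩
    simp only at hm hn
    have h1 : ψ (X ^ (n + m) * b) = X ^ m * ψ (X ^ n * b) := by
      apply IsFractionRing.injective F⟦X⟧ K
      rw [hn _ ⟨X ^ m * b, by ring⟩, map_mul _ (X ^ m), hn _ ⟨b, rfl⟩]
      simp only [map_mul, map_pow]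
      ring
    have h2 := hm (ψ (X ^ (n + m) * b)) ⟨_, h1⟩
    rw [hn _ ⟨X ^ m * b, by ring⟩] at h2
    simpa [mul_assoc] using h2
  one_mem' := ⟨0, by simp⟩
  add_mem' := by
    rintro ⟨φ, q⟩ ⟨ψ, r⟩ ⟨m, hm⟩ ⟨n, hn⟩
    refine ⟨max m n, fun a ha ↦ ?_⟩
    have h1 := hm a ((pow_dvd_pow _ (le_max_left m n)).trans ha)
    have h2 := hn a ((pow_dvd_pow _ (le_max_right m n)).trans ha)
    simp only at h1 h2
    simp [h1, h2, add_mul]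
  zero_mem' := ⟨0, by simp⟩
  neg_mem' := by
    rintro ⟨φ, q⟩ ⟨m, hm⟩
    refine ⟨m, fun a ha ↦ ?_⟩
    have h1 := hm a ha
    simp only at h1
    simp [h1]

variable {F K}

theorem exists_algebraMap_eq_mul_X_pow (q : K) :
    ∃ (n : ℕ) (c : F⟦X⟧), algebraMap F⟦X⟧ K c = q * algebraMap F⟦X⟧ K X ^ n := by
  obtain ⟨a, b, hb, rfl⟩ := IsFractionRing.div_surjective (A := F⟦X⟧) q
  have hb0 := nonZeroDivisors.ne_zero hb
  obtain ⟨n, d, hd⟩ := exists_dvd_X_pow hb0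
  have hb' : algebraMap F⟦X⟧ K b ≠ 0 := by
    simpa using (map_ne_zero_iff _ (IsFractionRing.injective F⟦X⟧ K)).2 hb0
  refine ⟨n, a * d, ?_⟩
  rw [← map_pow, hd, map_mul, map_mul]
  field_simp

theorem isVonNeumannRegularRing_bergmanRing : IsVonNeumannRegularRing (bergmanRing F K) := by
  rintro ⟨⟨φ, q⟩, n, hn⟩
  simp only at hn
  have inj := IsFractionRing.injective F⟦X⟧ K
  suffices h : ∃ (ψ : Module.End F F⟦X⟧) (m : ℕ), (∀ a, φ (ψ (φ a)) = φ a) ∧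
      ∀ a, X ^ m ∣ a → algebraMap F⟦X⟧ K (ψ a) = q⁻¹ * algebraMap F⟦X⟧ K a by
    obtain ⟨ψ, m, h1, h2⟩ := h
    refine ⟨⟨⟨ψ, q⁻¹⟩, m, h2⟩, Subtype.ext (Prod.ext (LinearMap.ext h1) ?_)⟩
    exact mul_inv_mul_cancel q
  by_cases hq : q = 0
  -- With symbol zero, `φ` factors through a finite-dimensional quotient, so its range meets the
  -- multiples of some `X ^ m` trivially and `ψ` may vanish on them.
  · subst hq
    have hker : multiplesXPow F n ≤ LinearMap.ker φ := fun a ha ↦ inj <| by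
      rw [hn a (mem_multiplesXPow.1 ha), zero_mul, map_zero]
    have hfin : FiniteDimensional F (LinearMap.range φ) := by
      have : FiniteDimensional F (F⟦X⟧ ⧸ multiplesXPow F n) :=
        ((firstCoeffs F n).quotKerEquivOfSurjective
          (firstCoeffs_surjective n)).symm.finiteDimensional
      rw [← Submodule.range_liftQ _ φ hker]
      infer_instance
    obtain ⟨m, hm⟩ := exists_forall_mem_of_X_pow_dvd (LinearMap.range φ)
    obtain ⟨ψ, h1, h2⟩ := φ.exists_comp_comp_eq_self_of_eqOn (multiplesXPow F m) 0 fun a ha ↦ by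
      simp [hm _ ⟨a, rfl⟩ (mem_multiplesXPow.1 ha)]
    exact ⟨ψ, m, h1, fun a ha ↦ by simp [h2 a (mem_multiplesXPow.2 ha)]⟩
  -- On multiples of `X ^ (m + n)`, prescribe `ψ` as multiplication by `q⁻¹`: the factor `X ^ m`
  -- clears the denominator, and `X ^ n` keeps the result where `φ` multiplies by `q`.
  · obtain ⟨m, c, hc⟩ := exists_algebraMap_eq_mul_X_pow (F := F) q⁻¹
    obtain ⟨D, hD⟩ := (LinearMap.mulLeft F (X ^ (m + n) : F⟦X⟧)).exists_leftInverse_of_injective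
      (LinearMap.ker_eq_bot.2 (mul_right_injective₀ (pow_ne_zero _ X_ne_zero)))
    replace hD : ∀ b, D (X ^ (m + n) * b) = b := fun b ↦ LinearMap.congr_fun hD b
    have ht : ∀ b, algebraMap F⟦X⟧ K (c * X ^ n * b) = q⁻¹ * algebraMap F⟦X⟧ K (X ^ (m + n) * b) := by
      intro b
      simp only [map_mul, map_pow, hc]
      ring
    obtain ⟨ψ, h1, h2⟩ := φ.exists_comp_comp_eq_self_of_eqOn (multiplesXPow F (m + n))
      (LinearMap.mulLeft F (c * X ^ n) ∘ₗ D) fun a ha ↦ by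
        obtain ⟨b, hb⟩ := mem_multiplesXPow.1 ha
        rw [hb, LinearMap.comp_apply, hD, LinearMap.mulLeft_apply]
        apply inj
        rw [hn _ ⟨c * b, by ring⟩, ht, mul_inv_cancel_left₀ hq]
    refine ⟨ψ, m + n, h1, fun a ha ↦ ?_⟩
    rw [h2 a (mem_multiplesXPow.2 ha)]
    obtain ⟨b, rfl⟩ := ha
    rw [LinearMap.comp_apply, hD, LinearMap.mulLeft_apply, ht]

/-- The symbol of a unit of Bergman's ring is a power series, since a Fredholm operator whose
symbol has nonzero valuation has nonzero index. -/
theorem symbol_mem_range_of_isUnit {u : bergmanRing F K} (hu : IsUnit u) :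
    u.1.2 ∈ (algebraMap F⟦X⟧ K).range := by
  rcases ValuationRing.isInteger_or_isInteger F⟦X⟧ u.1.2 with h | ⟨c, hc⟩
  · exact h
  have inj := IsFractionRing.injective F⟦X⟧ K
  obtain ⟨v, huv, hvu⟩ := isUnit_iff_exists.1 hu
  have hq : u.1.2 * v.1.2 = 1 := congrArg (fun z : bergmanRing F K ↦ z.1.2) huv
  have hφ : v.1.1 * u.1.1 = 1 := congrArg (fun z : bergmanRing F K ↦ z.1.1) hvu
  rw [inv_eq_of_mul_eq_one_right hq] at hc
  by_cases hcu : IsUnit c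
  · obtain ⟨d, hd⟩ := hcu.exists_right_inv
    refine ⟨d, ?_⟩
    rw [← mul_one (algebraMap F⟦X⟧ K d), ← hq, ← hc, mul_left_comm, ← map_mul, mul_comm d, hd,
      map_one, mul_one]
  -- If the symbol `c` of the inverse `v` is divisible by `X`, then `v` raises the `X`-adic order on
  -- multiples of `X ^ n`, so it cannot be surjective.
  · obtain ⟨n, hn⟩ := v.2
    obtain ⟨d, rfl⟩ : X ∣ c := by
      rw [X_dvd_iff]
      by_contra h0
      exact hcu (isUnit_iff_constantCoeff.2 (Ne.isUnit h0))
    refine (not_surjective_of_X_pow_succ_dvd v.1.1 n (fun a ↦ ⟨d * a, inj ?_⟩)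
      fun a ↦ ⟨u.1.1 a, LinearMap.congr_fun hφ a⟩).elim
    rw [hn _ ⟨a, rfl⟩, ← hc, ← map_mul]
    congr 1
    ring

/-- Any linear left inverse of multiplication by `X`, such as the backward shift, has this symbol.
-/
theorem exists_bergmanRing_symbol_eq_inv_X :
    ∃ s : bergmanRing F K, s.1.2 = (algebraMap F⟦X⟧ K X)⁻¹ := by
  obtain ⟨D, hD⟩ := (LinearMap.mulLeft F (X : F⟦X⟧)).exists_leftInverse_of_injective
    (LinearMap.ker_eq_bot.2 (mul_right_injective₀ X_ne_zero))
  refine ⟨⟨⟨D, (algebraMap F⟦X⟧ K X)⁻¹⟩, 1, ?_⟩, rfl⟩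
  rintro _ ⟨b, rfl⟩
  have hX : algebraMap F⟦X⟧ K X ≠ 0 :=
    (map_ne_zero_iff _ (IsFractionRing.injective F⟦X⟧ K)).2 X_ne_zero
  have h1 : D (X * b) = b := LinearMap.congr_fun hD b
  simp only [pow_one, h1, map_mul, inv_mul_cancel_left₀ hX]

theorem inv_X_notMem_range : (algebraMap F⟦X⟧ K X)⁻¹ ∉ (algebraMap F⟦X⟧ K).range := by
  rintro ⟨c, hc⟩
  have hX : algebraMap F⟦X⟧ K X ≠ 0 :=
    (map_ne_zero_iff _ (IsFractionRing.injective F⟦X⟧ K)).2 X_ne_zero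
  refine X_prime.not_isUnit (IsUnit.of_mul_eq_one c (IsFractionRing.injective F⟦X⟧ K ?_))
  rw [map_mul, hc, mul_inv_cancel₀ hX, map_one]

theorem not_isGeneratedByUnits_bergmanRing : ¬ IsGeneratedByUnits (bergmanRing F K) := by
  intro h
  obtain ⟨s, hs⟩ := exists_bergmanRing_symbol_eq_inv_X (F := F) (K := K)
  have hle : Subring.closure {u : bergmanRing F K | IsUnit u} ≤ (algebraMap F⟦X⟧ K).range.comap
      ((RingHom.snd _ _).comp (bergmanRing F K).subtype) :=
    -- Elements whose symbol is a power series form a subring, so containing the units is enough.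
    Subring.closure_le.2 fun u hu ↦ symbol_mem_range_of_isUnit hu
  rw [h] at hle
  have hmem : s.1.2 ∈ (algebraMap F⟦X⟧ K).range := hle (Subring.mem_top s)
  rw [hs] at hmem
  exact inv_X_notMem_range hmem

theorem not_isCleanRing_bergmanRing : ¬ IsCleanRing (bergmanRing F K) := by
  intro h
  obtain ⟨s, hs⟩ := exists_bergmanRing_symbol_eq_inv_X (F := F) (K := K)
  obtain ⟨e, u, he, hu, rfl⟩ := h s
  have he' : IsIdempotentElem e.1.2 := congrArg (fun z : bergmanRing F K ↦ z.1.2) he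
  refine inv_X_notMem_range (F := F) (K := K) ?_
  rw [← hs]
  refine add_mem ?_ (symbol_mem_range_of_isUnit hu)
  rcases IsIdempotentElem.iff_eq_zero_or_one.1 he' with h0 | h1
  · rw [h0]; exact zero_mem _
  · rw [h1]; exact one_mem _

end PowerSeries

theorem mainTheorem11 :
    ∃ (R : Type) (_ : Ring R),
      IsVonNeumannRegularRing R ∧ ¬ IsGeneratedByUnits R ∧
        IsDRegularlyNilClean R ∧ ¬ IsCleanRing R ∧ ¬ IsStronglyCleanRing R :=
  ⟨bergmanRing ℚ (FractionRing ℚ⟦X⟧), inferInstance, isVonNeumannRegularRing_bergmanRing,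
    not_isGeneratedByUnits_bergmanRing, isVonNeumannRegularRing_bergmanRing.isDRegularlyNilClean,
    not_isCleanRing_bergmanRing, fun h ↦ not_isCleanRing_bergmanRing h.isCleanRing⟩
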